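/- For an additive category $C$ and a full additive subcategory $D\subset C$, the factor category $C/D$ has the same objects as $C$ and morphism groups $(C/D)(X,Y)=C(X,Y)/\bigl(\sum_{Z\in \mathrm{Obj}\,D}C(Z,Y)\circ C(X,Z)\bigr)$. The Karoubization $\mathrm{Kar}(C)$ is the category of pairs $(X,p)$ with $X\in\mathrm{Obj}\,C$ and $p\in C(X,X)$, $p^2=p$, where the morphisms $(X,p)\to(X',p')$ are the $f\in C(X,X')$ with $p'\circ f=f\circ p=f$; $C$ is fully embedded in it by $X\mapsto(X,\mathrm{id}_X)$. The small envelope of $C$ is the full subcategory of $\mathrm{Kar}(C)$ consisting of those $Y$ for which there is $X\in\mathrm{Obj}\,C$ such that $X\oplus Y$ is isomorphic to an object of $C$. Let $A$ be an additive category, $B\subset A$ a full additive subcategory, and $A'$ the small envelope of $A$; regard $B$ as a subcategory of $A'$ via the embedding $A\to A'$. Then the small envelope of $A/B$ coincides with $A'/B$: there is an additive equivalence of categories from $A'/B$ to the small envelope of $A/B$ such that, up to natural isomorphism, the composite of $A'\to A'/B$, this equivalence and the inclusion of the small envelope of $A/B$ into $\mathrm{Kar}(A/B)$ is the composite of the inclusion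 $A'\subset\mathrm{Kar}(A)$ and the functor $\mathrm{Kar}(A)\to\mathrm{Kar}(A/B)$ induced by the projection $A\to A/B$. In particular, up to natural isomorphism, it is compatible with the canonical functors from $A$ to $A'/B$ and to the small envelope of $A/B$. -/

import Mathlib

open CategoryTheory CategoryTheory.Limits CategoryTheory.Idempotents

universe v u

/-- For an object property `P` of a preadditive category, the subgroup
`∑_{Z in P} C(Z, Y) ∘ C(X, Z)` of `C(X, Y)`. -/
def factorIdeal {C : Type u} [Category.{v} C] [Preadditive C] (P : ObjectProperty C) (X Y : C) :
    AddSubgroup (X ⟶ Y) :=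
  AddSubgroup.closure {h : X ⟶ Y | ∃ (Z : C) (_ : P Z) (a : X ⟶ Z) (b : Z ⟶ Y), a ≫ b = h}

theorem comp_mem_factorIdeal_left {C : Type u} [Category.{v} C] [Preadditive C]
    (P : ObjectProperty C) {X Y Z : C} (f : X ⟶ Y) {g : Y ⟶ Z} (hg : g ∈ factorIdeal P Y Z) :
    f ≫ g ∈ factorIdeal P X Z := by
  refine AddSubgroup.closure_induction (p := fun g _ => f ≫ g ∈ factorIdeal P X Z)
    ?_ ?_ ?_ ?_ hg
  · rintro _ ⟨W, hW, a, b, rfl⟩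
    exact AddSubgroup.subset_closure ⟨W, hW, f ≫ a, b, by simp⟩
  · simp
  · intro x y _ _ hx hy
    simpa using add_mem hx hy
  · intro x _ hx
    simpa using neg_mem hx

theorem comp_mem_factorIdeal_right {C : Type u} [Category.{v} C] [Preadditive C]
    (P : ObjectProperty C) {X Y Z : C} {f : X ⟶ Y} (g : Y ⟶ Z) (hf : f ∈ factorIdeal P X Y) :
    f ≫ g ∈ factorIdeal P X Z := by
  refine AddSubgroup.closure_induction (p := fun f _ => f ≫ g ∈ factorIdeal P X Z)
    ?_ ?_ ?_ ?_ hf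
  · rintro _ ⟨W, hW, a, b, rfl⟩
    exact AddSubgroup.subset_closure ⟨W, hW, a, b ≫ g, by simp⟩
  · simp
  · intro x y _ _ hx hy
    simpa using add_mem hx hy
  · intro x _ hx
    simpa using neg_mem hx

/-- Two parallel morphisms are identified in the factor category when their difference lies in
the subgroup `factorIdeal P X Y`. -/
def factorRel {C : Type u} [Category.{v} C] [Preadditive C] (P : ObjectProperty C) : HomRel C :=
  fun X Y f g => f - g ∈ factorIdeal P X Y

instance factorRel_congruence {C : Type u} [Category.{v} C] [Preadditive C]
    (P : ObjectProperty C) : Congruence (factorRel P) where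
  equivalence := by
    intro X Y
    refine ⟨fun f => ?_, fun {f g} h => ?_, fun {f g k} h₁ h₂ => ?_⟩
    · change f - f ∈ factorIdeal P X Y
      simp
    · change g - f ∈ factorIdeal P X Y
      simpa using neg_mem (show f - g ∈ factorIdeal P X Y from h)
    · change f - k ∈ factorIdeal P X Y
      simpa using add_mem (show f - g ∈ factorIdeal P X Y from h₁)
        (show g - k ∈ factorIdeal P X Y from h₂)
  comp_left := by
    intro X Y Z f g g' h
    change f ≫ g - f ≫ g' ∈ factorIdeal P X Z
    rw [← Preadditive.comp_sub]
    exact comp_mem_factorIdeal_left P f h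
  comp_right := by
    intro X Y Z f f' g h
    change f ≫ g - f' ≫ g ∈ factorIdeal P X Z
    rw [← Preadditive.sub_comp]
    exact comp_mem_factorIdeal_right P g h

theorem factorRel_add {C : Type u} [Category.{v} C] [Preadditive C] (P : ObjectProperty C)
    ⦃X Y : C⦄ (f₁ f₂ g₁ g₂ : X ⟶ Y) (hf : factorRel P f₁ f₂) (hg : factorRel P g₁ g₂) :
    factorRel P (f₁ + g₁) (f₂ + g₂) := by
  change f₁ + g₁ - (f₂ + g₂) ∈ factorIdeal P X Y
  rw [add_sub_add_comm]
  exact add_mem hf hg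

/-- The factor category `C / P`: its objects are those of `C`, and
`(C / P)(X, Y) = C(X, Y) / ∑_{Z in P} C(Z, Y) ∘ C(X, Z)`. -/
abbrev FactorCategory {C : Type u} [Category.{v} C] [Preadditive C] (P : ObjectProperty C) :
    Type u :=
  CategoryTheory.Quotient (factorRel P)

instance factorCategory_preadditive {C : Type u} [Category.{v} C] [Preadditive C]
    (P : ObjectProperty C) : Preadditive (FactorCategory P) :=
  CategoryTheory.Quotient.preadditive (factorRel P) (factorRel_add P)

/-- The projection functor `C ⥤ C / P`. -/
abbrev factorFunctor {C : Type u} [Category.{v} C] [Preadditive C] (P : ObjectProperty C) :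
    C ⥤ FactorCategory P :=
  CategoryTheory.Quotient.functor (factorRel P)

instance factorFunctor_additive {C : Type u} [Category.{v} C] [Preadditive C]
    (P : ObjectProperty C) : (factorFunctor P).Additive :=
  CategoryTheory.Quotient.functor_additive (factorRel P) (factorRel_add P)

instance factorCategory_hasFiniteBiproducts {C : Type u} [Category.{v} C] [Preadditive C]
    [HasFiniteBiproducts C] (P : ObjectProperty C) : HasFiniteBiproducts (FactorCategory P) where
  out _ :=
    { has_biproduct := fun F =>
        HasBiproduct.mk
          { bicone := (factorFunctor P).mapBicone (biproduct.bicone fun j => (F j).as)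
            isBilimit := isBilimitOfPreserves (factorFunctor P)
              (biproduct.isBilimit fun j => (F j).as) } }

instance karoubi_binaryBiproducts {C : Type u} [Category.{v} C] [Preadditive C]
    [HasFiniteBiproducts C] : HasBinaryBiproducts (Karoubi C) :=
  hasBinaryBiproducts_of_finite_biproducts _

/-- The objects `Y` of the Karoubi envelope of `C` such that `X ⊞ Y` belongs (up to isomorphism)
to `C`, for some object `X` of `C`. -/
def smallEnvelope (C : Type u) [Category.{v} C] [Preadditive C] [HasFiniteBiproducts C] :
    ObjectProperty (Karoubi C) :=
  fun Y => ∃ X Z : C, Nonempty ((toKaroubi C).obj X ⊞ Y ≅ (toKaroubi C).obj Z)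

/-- The small envelope of `C`, as a full subcategory of its Karoubi envelope. -/
abbrev SmallEnvelope (C : Type u) [Category.{v} C] [Preadditive C] [HasFiniteBiproducts C] :=
  (smallEnvelope C).FullSubcategory

theorem smallEnvelope_toKaroubi (C : Type u) [Category.{v} C] [Preadditive C]
    [HasFiniteBiproducts C] (X : C) : smallEnvelope C ((toKaroubi C).obj X) :=
  haveI := hasBinaryBiproducts_of_finite_biproducts C
  haveI := preservesBinaryBiproducts_of_preservesBiproducts (toKaroubi C)
  ⟨X, X ⊞ X, ⟨((toKaroubi C).mapBiprod X X).symm⟩⟩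

/-- The canonical full embedding of `C` in its small envelope. -/
abbrev toSmallEnvelope (C : Type u) [Category.{v} C] [Preadditive C] [HasFiniteBiproducts C] :
    C ⥤ SmallEnvelope C :=
  (smallEnvelope C).lift (toKaroubi C) (smallEnvelope_toKaroubi C)

/-- The functor `Karoubi C ⥤ Karoubi D`, `(X, p) ↦ (F X, F p)`, induced by `F : C ⥤ D`. -/
abbrev karoubiMap {C D : Type u} [Category.{v} C] [Category.{v} D] (F : C ⥤ D) :
    Karoubi C ⥤ Karoubi D :=
  (functorExtension₂ C D).obj F

/-! The projection `A ⥤ A/B` induces a functor between small envelopes; it is full, kills exactly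
the ideal generated by `B`, and is essentially surjective, so its factorization through the quotient
by that ideal is an equivalence. Fullness and the kernel are computed in `A`, by composing with the
idempotents on both sides. The kernel also needs a morphism of the ideal to factor through a single
object of `B` (`exists_factorization_of_mem_factorIdeal`). Essential surjectivity is the main point.
If `X ⊞ Y ≅ Z` in `Karoubi (A/B)`, lifts `i`, `r` to `A` of the inclusion and projection of `X`
satisfy `i ≫ r = 𝟙` only modulo `B`. The error factors through some `W` in `B`; replacing `Z` by `Z
⊞ W`, which is isomorphic to `Z` in `A/B`, absorbs it. Then `X` is an honest retract in `A`, and its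
complementary idempotent gives a lift of `Y`. -/

/-- Two retracts of isomorphic objects which split corresponding idempotents are isomorphic. -/
def isoOfSplittings {C : Type u} [Category.{v} C] {X X' Z Z' : C} (u : Z ≅ Z')
    (s : X ⟶ Z) (t : Z ⟶ X) (s' : X' ⟶ Z') (t' : Z' ⟶ X') (h : s ≫ t = 𝟙 X)
    (h' : s' ≫ t' = 𝟙 X') (w : (t ≫ s) ≫ u.hom = u.hom ≫ t' ≫ s') : X ≅ X' where
  hom := s ≫ u.hom ≫ t'
  inv := s' ≫ u.inv ≫ t
  hom_inv_id := by
    have : (u.hom ≫ t' ≫ s') ≫ u.inv = t ≫ s := by rw [← w]; simp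
    calc _ = s ≫ ((u.hom ≫ t' ≫ s') ≫ u.inv) ≫ t := by simp
      _ = (s ≫ t) ≫ (s ≫ t) := by rw [this]; simp
      _ = _ := by rw [h]; simp
  inv_hom_id := by
    have : u.inv ≫ (t ≫ s) ≫ u.hom = t' ≫ s' := by rw [w]; simp
    calc _ = s' ≫ (u.inv ≫ (t ≫ s) ≫ u.hom) ≫ t' := by simp
      _ = (s' ≫ t') ≫ (s' ≫ t') := by rw [this]; simp
      _ = _ := by rw [h']; simp

/-- Complementary retracts of an object decompose it as a biproduct. -/
theorem nonempty_biprod_iso_of_total {C : Type u} [Category.{v} C] [Preadditive C]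
    [HasBinaryBiproducts C] {X Y Z : C} (i : X ⟶ Z) (r : Z ⟶ X) (s : Y ⟶ Z) (t : Z ⟶ Y)
    (hi : i ≫ r = 𝟙 X) (hs : s ≫ t = 𝟙 Y) (hit : i ≫ t = 0) (hsr : s ≫ r = 0)
    (total : r ≫ i + t ≫ s = 𝟙 Z) : Nonempty (X ⊞ Y ≅ Z) := by
  let b : BinaryBicone X Y :=
    { pt := Z, fst := r, snd := t, inl := i, inr := s, inl_fst := hi, inl_snd := hit,
      inr_fst := hsr, inr_snd := hs }
  exact ⟨(biprod.uniqueUpToIso X Y (isBinaryBilimitOfTotal b total)).symm⟩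

/-- The sum of two morphisms factoring through objects of an additive full subcategory factors
through an object of it, as do zero morphisms: the ideal of such morphisms needs no sums. -/
theorem exists_factorization_of_mem_factorIdeal {C : Type u} [Category.{v} C] [Preadditive C]
    (P : ObjectProperty C) [HasFiniteBiproducts P.FullSubcategory] {X Y : C} {f : X ⟶ Y}
    (hf : f ∈ factorIdeal P X Y) :
    ∃ (Z : C) (_ : P Z) (a : X ⟶ Z) (b : Z ⟶ Y), a ≫ b = f := by
  have := hasBinaryBiproducts_of_finite_biproducts P.FullSubcategory
  induction hf using AddSubgroup.closure_induction with
  | mem f hf => exact hf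
  | zero =>
    have : HasZeroObject P.FullSubcategory := hasZeroObject_of_hasFiniteBiproducts _
    obtain ⟨Z, -⟩ := HasZeroObject.zero (C := P.FullSubcategory)
    exact ⟨_, Z.property, 0, 0, by simp⟩
  | add f g _ _ hf hg =>
    obtain ⟨Z, hZ, a, b, rfl⟩ := hf
    obtain ⟨W, hW, c, d, rfl⟩ := hg
    let Z' : P.FullSubcategory := ⟨Z, hZ⟩
    let W' : P.FullSubcategory := ⟨W, hW⟩
    -- The biproduct is formed inside `P.FullSubcategory`, so its underlying object satisfies `P`;
    -- its identities are carried to `C` by `P.ι`.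
    refine ⟨_, (Z' ⊞ W').property,
      a ≫ P.ι.map (biprod.inl : Z' ⟶ Z' ⊞ W') + c ≫ P.ι.map (biprod.inr : W' ⟶ Z' ⊞ W'),
      P.ι.map (biprod.fst : Z' ⊞ W' ⟶ Z') ≫ b + P.ι.map (biprod.snd : Z' ⊞ W' ⟶ W') ≫ d, ?_⟩
    have h₁ : P.ι.map (biprod.inl : Z' ⟶ Z' ⊞ W') ≫ P.ι.map biprod.fst = 𝟙 Z := by
      rw [← P.ι.map_comp]; simp [Z']
    have h₂ : P.ι.map (biprod.inr : W' ⟶ Z' ⊞ W') ≫ P.ι.map biprod.snd = 𝟙 W := by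
      rw [← P.ι.map_comp]; simp [W']
    have h₃ : P.ι.map (biprod.inl : Z' ⟶ Z' ⊞ W') ≫ P.ι.map biprod.snd = 0 := by
      rw [← P.ι.map_comp]; simp
    have h₄ : P.ι.map (biprod.inr : W' ⟶ Z' ⊞ W') ≫ P.ι.map biprod.fst = 0 := by
      rw [← P.ι.map_comp]; simp
    simp only [Preadditive.add_comp, Preadditive.comp_add, Category.assoc,
      reassoc_of% h₁, reassoc_of% h₂, reassoc_of% h₃, reassoc_of% h₄]
    simp only [zero_comp, comp_zero, add_zero, zero_add]
    exact congrArg₂ (· + ·) (congrArg (a ≫ ·) (Category.id_comp b))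
      (congrArg (c ≫ ·) (Category.id_comp d))
  | neg f _ hf =>
    obtain ⟨Z, hZ, a, b, rfl⟩ := hf
    exact ⟨Z, hZ, -a, b, by simp⟩

instance karoubiMap_additive {C D : Type u} [Category.{v} C] [Category.{v} D] [Preadditive C]
    [Preadditive D] (F : C ⥤ D) [F.Additive] : (karoubiMap F).Additive where
  map_add {X Y f g} := by
    ext
    exact F.map_add

/-- Compatibility of `karoubiMap` with the embeddings in the Karoubi envelopes. -/
def toKaroubiCompKaroubiMapIso {C D : Type u} [Category.{v} C] [Category.{v} D] (F : C ⥤ D) :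
    toKaroubi C ⋙ karoubiMap F ≅ F ⋙ toKaroubi D :=
  (functorExtension₂CompWhiskeringLeftToKaroubiIso C D).app F

theorem smallEnvelope_karoubiMap {C D : Type u} [Category.{v} C] [Category.{v} D] [Preadditive C]
    [Preadditive D] [HasFiniteBiproducts C] [HasFiniteBiproducts D] (F : C ⥤ D) [F.Additive]
    {Y : Karoubi C} (hY : smallEnvelope C Y) : smallEnvelope D ((karoubiMap F).obj Y) := by
  obtain ⟨X, Z, ⟨w⟩⟩ := hY
  have := preservesBinaryBiproducts_of_preservesBiproducts (karoubiMap F)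
  let c := toKaroubiCompKaroubiMapIso F
  exact ⟨F.obj X, F.obj Z, ⟨biprod.mapIso (c.app X).symm (Iso.refl _) ≪≫
    ((karoubiMap F).mapBiprod _ _).symm ≪≫ (karoubiMap F).mapIso w ≪≫ c.app Z⟩⟩

/-- The functor between small envelopes induced by an additive functor. -/
abbrev smallEnvelopeMap {C D : Type u} [Category.{v} C] [Category.{v} D] [Preadditive C]
    [Preadditive D] [HasFiniteBiproducts C] [HasFiniteBiproducts D] (F : C ⥤ D) [F.Additive] :
    SmallEnvelope C ⥤ SmallEnvelope D :=
  (smallEnvelope D).lift ((smallEnvelope C).ι ⋙ karoubiMap F)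
    fun Y => smallEnvelope_karoubiMap F Y.property

/-! ### The kernel of the functor between small envelopes, and its fullness -/

theorem factorFunctor_map_eq_iff {C : Type u} [Category.{v} C] [Preadditive C]
    (P : ObjectProperty C) {X Y : C} (f g : X ⟶ Y) :
    (factorFunctor P).map f = (factorFunctor P).map g ↔ f - g ∈ factorIdeal P X Y :=
  CategoryTheory.Quotient.functor_map_eq_iff (factorRel P) f g

theorem factorFunctor_map_eq_zero_iff {C : Type u} [Category.{v} C] [Preadditive C]
    (P : ObjectProperty C) {X Y : C} (f : X ⟶ Y) :
    (factorFunctor P).map f = 0 ↔ f ∈ factorIdeal P X Y := by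
  rw [← (factorFunctor P).map_zero, factorFunctor_map_eq_iff, sub_zero]

theorem factorFunctor_map_eq_zero_of_factor {C : Type u} [Category.{v} C] [Preadditive C]
    (P : ObjectProperty C) {X Y Z : C} (hZ : P Z) (a : X ⟶ Z) (b : Z ⟶ Y) :
    (factorFunctor P).map (a ≫ b) = 0 :=
  (factorFunctor_map_eq_zero_iff P _).2 (AddSubgroup.subset_closure ⟨Z, hZ, a, b, rfl⟩)

/-- Objects of `P` become zero in the factor category. -/
theorem isZero_factorFunctor_obj {C : Type u} [Category.{v} C] [Preadditive C]
    (P : ObjectProperty C) {Z : C} (hZ : P Z) : IsZero ((factorFunctor P).obj Z) := by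
  rw [IsZero.iff_id_eq_zero, ← (factorFunctor P).map_id, ← Category.id_comp (𝟙 Z)]
  exact factorFunctor_map_eq_zero_of_factor P hZ _ _

/-- A morphism of the small envelope of `A` vanishes in `Karoubi (A / B)` if and only if it
belongs to the ideal generated by `B` in the small envelope. -/
theorem smallEnvelopeMap_factorFunctor_map_eq_zero_iff {A : Type u} [Category.{v} A]
    [Preadditive A] [HasFiniteBiproducts A] (B : ObjectProperty A)
    [HasFiniteBiproducts B.FullSubcategory] {X Y : SmallEnvelope A} (f : X ⟶ Y) :
    (smallEnvelopeMap (factorFunctor B)).map f = 0 ↔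
      f ∈ factorIdeal (B.map (toSmallEnvelope A)) X Y := by
  constructor
  · intro hf
    have hf' : (factorFunctor B).map f.hom.f = 0 :=
      congrArg (fun g => Karoubi.Hom.f (InducedCategory.Hom.hom g)) hf
    obtain ⟨Z, hZ, a, b, hab⟩ := exists_factorization_of_mem_factorIdeal B
      ((factorFunctor_map_eq_zero_iff B _).1 hf')
    -- A morphism of `Karoubi A` absorbs the idempotents `p`, `q` of its ends, so `f = p ≫ a ≫ b ≫
    -- q`.
    refine AddSubgroup.subset_closure ⟨(toSmallEnvelope A).obj Z, B.prop_map_obj _ hZ,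
      (smallEnvelope A).homMk (X.obj.decompId_i ≫ (toKaroubi A).map a),
      (smallEnvelope A).homMk ((toKaroubi A).map b ≫ Y.obj.decompId_p), ?_⟩
    ext
    simp [reassoc_of% hab]
  · intro hf
    induction hf using AddSubgroup.closure_induction with
    | mem f hf =>
      obtain ⟨Z, ⟨W, hW, ⟨w⟩⟩, a, b, rfl⟩ := hf
      have h : IsZero ((smallEnvelopeMap (factorFunctor B)).obj Z) := by
        refine IsZero.of_iso ?_ ((smallEnvelopeMap (factorFunctor B)).mapIso w.symm)
        rw [IsZero.iff_id_eq_zero]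
        ext
        exact (isZero_factorFunctor_obj B hW).eq_of_src _ _
      rw [Functor.map_comp, h.eq_of_tgt ((smallEnvelopeMap (factorFunctor B)).map a) 0, zero_comp]
    | zero => exact Functor.map_zero _ _ _
    | add f g _ _ hf hg => rw [Functor.map_add, hf, hg, add_zero]
    | neg f _ hf => rw [Functor.map_neg, hf, neg_zero]

instance smallEnvelopeMap_factorFunctor_full {A : Type u} [Category.{v} A] [Preadditive A]
    [HasFiniteBiproducts A] (B : ObjectProperty A) :
    (smallEnvelopeMap (factorFunctor B)).Full where
  map_surjective {X Y} g := by
    obtain ⟨f, hf⟩ := (factorFunctor B).map_surjective g.hom.f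
    -- The lift `f` need not be compatible with the idempotents; composing with them on both sides
    -- makes it so and does not change its image `g`.
    refine ⟨(smallEnvelope A).homMk
      (X.obj.decompId_i ≫ (toKaroubi A).map f ≫ Y.obj.decompId_p), ?_⟩
    ext
    have h := g.hom.comm
    rw [← hf] at h
    refine Eq.trans ?_ (h.trans hf)
    exact ((factorFunctor B).map_comp _ _).trans
      (congrArg ((factorFunctor B).map _ ≫ ·) ((factorFunctor B).map_comp _ _))

/-! ### Essential surjectivity -/

/-- A direct sum complement, in the Karoubi envelope of the factor category, of an object of `A`
in another one lifts to the small envelope of `A`. -/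
theorem smallEnvelopeMap_factorFunctor_essSurj {A : Type u} [Category.{v} A] [Preadditive A]
    [HasFiniteBiproducts A] (B : ObjectProperty A) [HasFiniteBiproducts B.FullSubcategory] :
    (smallEnvelopeMap (factorFunctor B)).EssSurj where
  mem_essImage Y := by
    have := hasBinaryBiproducts_of_finite_biproducts A
    obtain ⟨Y, ⟨X⟩, ⟨Z⟩, ⟨w⟩⟩ := Y
    obtain ⟨i, hi⟩ := (factorFunctor B).map_surjective (biprod.inl ≫ w.hom).f
    obtain ⟨r, hr⟩ := (factorFunctor B).map_surjective (w.inv ≫ biprod.fst).f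
    have hir : 𝟙 X - i ≫ r ∈ factorIdeal B X X := by
      rw [← factorFunctor_map_eq_iff, Functor.map_comp, hi, hr, ← Karoubi.comp_f]
      simp
      rfl
    obtain ⟨W, hW, a, b, hab⟩ := exists_factorization_of_mem_factorIdeal B hir
    -- The extra components contribute `a ≫ b = 𝟙 X - i ≫ r`, exactly the defect of `i ≫ r`.
    let i' : X ⟶ Z ⊞ W := biprod.lift i a
    let r' : Z ⊞ W ⟶ X := biprod.desc r b
    have hir' : i' ≫ r' = 𝟙 X := by simp [i', r', hab]
    let e : Z ⊞ W ⟶ Z ⊞ W := 𝟙 _ - r' ≫ i'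
    have hie : i' ≫ e = 0 := by simp [e, reassoc_of% hir']
    have her : e ≫ r' = 0 := by simp [e, hir']
    have hee : e ≫ e = e := by
      change (𝟙 _ - r' ≫ i') ≫ e = e
      simp [hie]
    let Y' : Karoubi A := ⟨Z ⊞ W, e, hee⟩
    have hY' : smallEnvelope A Y' := by
      refine ⟨X, Z ⊞ W, nonempty_biprod_iso_of_total ((toKaroubi A).map i')
        ((toKaroubi A).map r') Y'.decompId_i Y'.decompId_p ?_ Y'.decompId.symm ?_ ?_ ?_⟩
      · rw [← Functor.map_comp, hir', CategoryTheory.Functor.map_id]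
      · exact Karoubi.hom_ext _ _ hie
      · exact Karoubi.hom_ext _ _ her
      · rw [← Karoubi.decomp_p, ← Functor.map_comp, ← Functor.map_add,
          ← CategoryTheory.Functor.map_id]
        simp [Y', e]
    let F := factorFunctor B
    have hinr : ∀ {V V' : A} (f : V ⟶ W) (g : W ⟶ V'), F.map (f ≫ g) = 0 := fun f g =>
      factorFunctor_map_eq_zero_of_factor B hW f g
    let u : F.obj Z ≅ F.obj (Z ⊞ W) :=
      { hom := F.map biprod.inl
        inv := F.map biprod.fst
        hom_inv_id := by rw [← F.map_comp, biprod.inl_fst, F.map_id]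
        inv_hom_id := by
          rw [← F.map_comp, ← F.map_id, ← biprod.total, F.map_add, hinr, add_zero] }
    -- `Y` splits the idempotent `𝟙 - r ≫ i` of `Z` in `A/B`, and the image of `Y'` splits that of
    -- `e`; it remains to see that `u` intertwines the two.
    refine ⟨⟨Y', hY'⟩, ⟨(smallEnvelope (FactorCategory B)).isoMk (isoOfSplittings
      ((toKaroubi (FactorCategory B)).mapIso u)
      (biprod.inr ≫ w.hom) (w.inv ≫ biprod.snd) ((karoubiMap F).obj Y').decompId_i
      ((karoubiMap F).obj Y').decompId_p (by simp) (Karoubi.decompId _).symm ?_).symm⟩⟩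
    have hts : (w.inv ≫ biprod.snd) ≫ biprod.inr ≫ w.hom =
        (toKaroubi (FactorCategory B)).map (F.map (𝟙 Z - r ≫ i)) := by
      have h : (toKaroubi (FactorCategory B)).map (F.map (r ≫ i)) =
          (w.inv ≫ biprod.fst) ≫ biprod.inl ≫ w.hom := by
        ext
        exact (F.map_comp r i).trans (congrArg₂ (· ≫ ·) hr hi)
      rw [F.map_sub, Functor.map_sub, h, F.map_id, CategoryTheory.Functor.map_id, eq_sub_iff_add_eq]
      have ht := congrArg (fun g => w.inv ≫ g ≫ w.hom)
        (biprod.total (X := (toKaroubi (FactorCategory B)).obj ⟨X⟩) (Y := Y))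
      simp only [Preadditive.add_comp, Preadditive.comp_add, Category.assoc, Category.id_comp,
        Iso.inv_hom_id] at ht ⊢
      rw [add_comm]
      exact ht
    rw [hts]
    refine Eq.trans ?_ (congrArg (_ ≫ ·) (Karoubi.decomp_p ((karoubiMap F).obj Y')))
    refine ((toKaroubi (FactorCategory B)).map_comp _ _).symm.trans
      (Eq.trans (congrArg _ ?_) ((toKaroubi (FactorCategory B)).map_comp _ _))
    change F.map _ ≫ F.map biprod.inl = F.map biprod.inl ≫ F.map e
    rw [← F.map_comp, ← F.map_comp, ← sub_eq_zero, ← F.map_sub]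
    -- In `A` the intertwining fails only by a morphism through `W`, which vanishes in `A/B`.
    have : (𝟙 Z - r ≫ i) ≫ biprod.inl - biprod.inl ≫ e = (r ≫ a) ≫ (biprod.inr : W ⟶ Z ⊞ W) := by
      have hi' : i' = i ≫ biprod.inl + a ≫ biprod.inr := biprod.lift_eq
      have hr' : biprod.inl ≫ r' = r := biprod.inl_desc _ _
      simp only [e, Preadditive.sub_comp, Preadditive.comp_sub, Category.id_comp,
        Category.comp_id, Category.assoc, reassoc_of% hr', hi', Preadditive.comp_add]
      abel
    rw [this, hinr]

/-! ### The induced equivalence and its compatibilities -/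

/-- The functor from the factor category of the small envelope of `A` by the image of `B` to the
small envelope of `A / B`. -/
def factorSmallEnvelopeFunctor {A : Type u} [Category.{v} A] [Preadditive A]
    [HasFiniteBiproducts A] (B : ObjectProperty A) [HasFiniteBiproducts B.FullSubcategory] :
    FactorCategory (B.map (toSmallEnvelope A)) ⥤ SmallEnvelope (FactorCategory B) :=
  CategoryTheory.Quotient.lift _ (smallEnvelopeMap (factorFunctor B)) fun X Y f g h => by
    rw [← sub_eq_zero, ← Functor.map_sub]
    exact (smallEnvelopeMap_factorFunctor_map_eq_zero_iff B (f - g)).2 h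

section

variable {A : Type u} [Category.{v} A] [Preadditive A] [HasFiniteBiproducts A]
  (B : ObjectProperty A) [HasFiniteBiproducts B.FullSubcategory]

/-- The functor `factorSmallEnvelopeFunctor B` is induced by `smallEnvelopeMap`. -/
def factorFunctorCompFactorSmallEnvelopeFunctorIso :
    factorFunctor (B.map (toSmallEnvelope A)) ⋙ factorSmallEnvelopeFunctor B ≅
      smallEnvelopeMap (factorFunctor B) :=
  CategoryTheory.Quotient.lift.isLift _ _ _

instance factorSmallEnvelopeFunctor_additive : (factorSmallEnvelopeFunctor B).Additive where
  map_add {X Y f g} := by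
    obtain ⟨f, rfl⟩ := (factorFunctor _).map_surjective f
    obtain ⟨g, rfl⟩ := (factorFunctor _).map_surjective g
    rw [← Functor.map_add]
    exact (smallEnvelopeMap (factorFunctor B)).map_add

instance factorSmallEnvelopeFunctor_faithful : (factorSmallEnvelopeFunctor B).Faithful where
  map_injective {X Y f g} h := by
    obtain ⟨f, rfl⟩ := (factorFunctor _).map_surjective f
    obtain ⟨g, rfl⟩ := (factorFunctor _).map_surjective g
    rw [factorFunctor_map_eq_iff, ← smallEnvelopeMap_factorFunctor_map_eq_zero_iff,
      Functor.map_sub, sub_eq_zero]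
    exact h

instance factorSmallEnvelopeFunctor_full : (factorSmallEnvelopeFunctor B).Full where
  map_surjective {X Y} g := by
    obtain ⟨f, hf⟩ := (smallEnvelopeMap (factorFunctor B)).map_surjective (X := X.as) (Y := Y.as) g
    exact ⟨(factorFunctor _).map f, hf⟩

instance factorSmallEnvelopeFunctor_essSurj : (factorSmallEnvelopeFunctor B).EssSurj where
  mem_essImage Y := by
    obtain ⟨X, hX⟩ := (smallEnvelopeMap_factorFunctor_essSurj B).mem_essImage Y
    exact ⟨(factorFunctor _).obj X, hX⟩

instance factorSmallEnvelopeFunctor_isEquivalence :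
    (factorSmallEnvelopeFunctor B).IsEquivalence where

end

/-- Compatibility of `smallEnvelopeMap` with the embeddings in the small envelopes. -/
def toSmallEnvelopeCompSmallEnvelopeMapIso {C D : Type u} [Category.{v} C] [Category.{v} D]
    [Preadditive C] [Preadditive D] [HasFiniteBiproducts C] [HasFiniteBiproducts D] (F : C ⥤ D)
    [F.Additive] :
    toSmallEnvelope C ⋙ smallEnvelopeMap F ≅ F ⋙ toSmallEnvelope D :=
  ((smallEnvelope D).fullyFaithfulι.whiskeringRight C).preimageIso (toKaroubiCompKaroubiMapIso F)

theorem mainTheorem9 (A : Type u) [Category.{v} A] [Preadditive A] [HasFiniteBiproducts A]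
    (B : ObjectProperty A) [HasFiniteBiproducts B.FullSubcategory] :
    ∃ e : FactorCategory (B.map (toSmallEnvelope A)) ≌ SmallEnvelope (FactorCategory B),
      e.functor.Additive ∧
      Nonempty (factorFunctor (B.map (toSmallEnvelope A)) ⋙ e.functor ⋙
          (smallEnvelope (FactorCategory B)).ι ≅
        (smallEnvelope A).ι ⋙ karoubiMap (factorFunctor B)) ∧
      Nonempty (toSmallEnvelope A ⋙ factorFunctor (B.map (toSmallEnvelope A)) ⋙ e.functor ≅
        factorFunctor B ⋙ toSmallEnvelope (FactorCategory B)) := by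
  refine ⟨(factorSmallEnvelopeFunctor B).asEquivalence,
    inferInstanceAs (factorSmallEnvelopeFunctor B).Additive, ⟨?_⟩, ⟨?_⟩⟩
  · exact Functor.isoWhiskerRight (factorFunctorCompFactorSmallEnvelopeFunctorIso B)
      (smallEnvelope (FactorCategory B)).ι
  · exact Functor.isoWhiskerLeft (toSmallEnvelope A)
      (factorFunctorCompFactorSmallEnvelopeFunctorIso B) ≪≫
      toSmallEnvelopeCompSmallEnvelopeMapIso (factorFunctor B)
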